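/- A monoid $M$ is called *strongly sofic* if for every finite subset $K \subset M$ there is an integer $\Delta_K \ge 1$ such that for every $\varepsilon > 0$ there exist a non-empty finite set $D$ and a map $\sigma$ from $M$ to the monoid $\mathrm{Map}(D)$ of all self-maps of $D$ (under composition) satisfying: (1) $\sigma(1_M) = \mathrm{Id}_D$; (2) $d_D(\sigma(k_1k_2), \sigma(k_1)\sigma(k_2)) \le \varepsilon$ for all $k_1, k_2 \in K$; (3) $d_D(\sigma(k_1), \sigma(k_2)) \ge 1 - \varepsilon$ for all distinct $k_1, k_2 \in K$; (4) $|\sigma(k)^{-1}(v)| \le \Delta_K$ for all $k \in K$ and $v \in D$. Here $d_D(f,g) = \frac{1}{|D|}\,|\{v \in D : f(v) \ne g(v)\}|$ is the normalized Hamming metric. For a monoid $M$ and a finite set $A$, equip $A^M$ with the product topology of the discrete topologies on the factors $A$ and with the shift action $(mx)(m') = x(m'm)$ for $m, m' \in M$, $x \in A^M$. Let $\mathrm{CA}(M,A)$ be the monoid, under composition of maps, of all cellular automata on $A^M$, i.e. of all continuous maps $\tau \colon A^M \to A^M$ with $\tau(mx) = m\tau(x)$ for all $m \in M$ and $x \in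 A^M$. **Corollary.** Let $M$ be a strongly sofic monoid and let $A$ be a finite set. Then the monoid $\mathrm{CA}(M,A)$ is directly finite, that is, for all $\tau, \tau' \in \mathrm{CA}(M,A)$, if $\tau \circ \tau' = \mathrm{Id}$ then $\tau' \circ \tau = \mathrm{Id}$. In other words, $\mathrm{CA}(M,A)$ contains no submonoid isomorphic to the bicyclic monoid $\langle p, q : pq = 1\rangle$. -/

import Mathlib

/-- The normalized Hamming distance on the set `Map(D)` of self-maps of a non-empty finite set `D`:
the proportion of points of `D` at which `f` and `g` differ. -/
noncomputable def hammingMetric {D : Type*} (f g : D → D) : ℝ :=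
  ({v : D | f v ≠ g v}.ncard : ℝ) / (Nat.card D : ℝ)

/-- A monoid `M` is strongly sofic if for every finite subset `K` there is an integer `Δ ≥ 1`,
depending only on `K`, such that for every `ε > 0` there are a non-empty finite set `D` and a map
`σ : M → Map(D)` which is unital, `ε`-almost multiplicative on `K`, `ε`-almost free on `K`, and for
which every fibre of every `σ k`, `k ∈ K`, has at most `Δ` elements. -/
def StronglySofic (M : Type*) [Monoid M] : Prop :=
  ∀ K : Finset M, ∃ Δ : ℕ, 1 ≤ Δ ∧ ∀ ε : ℝ, 0 < ε →
    ∃ (D : Type) (_ : Finite D) (_ : Nonempty D) (σ : M → D → D),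
      σ 1 = id ∧
      (∀ k₁ ∈ K, ∀ k₂ ∈ K, hammingMetric (σ (k₁ * k₂)) (σ k₁ ∘ σ k₂) ≤ ε) ∧
      (∀ k₁ ∈ K, ∀ k₂ ∈ K, k₁ ≠ k₂ → 1 - ε ≤ hammingMetric (σ k₁) (σ k₂)) ∧
      (∀ k ∈ K, ∀ v : D, (σ k ⁻¹' {v}).ncard ≤ Δ)

/-- The shift action of a monoid `M` on the configurations `x : M → A`: `m x = x ∘ R_m`, where
`R_m` is the right multiplication by `m`. -/
def configShift {M A : Type*} [Monoid M] (m : M) (x : M → A) : M → A :=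
  fun m' => x (m' * m)

theorem configShift_one {M A : Type*} [Monoid M] (x : M → A) :
    configShift (1 : M) x = x := by
  funext m'
  simp [configShift]

theorem configShift_mul {M A : Type*} [Monoid M] (m₁ m₂ : M) (x : M → A) :
    configShift (m₁ * m₂) x = configShift m₁ (configShift m₂ x) := by
  funext m'
  simp [configShift, mul_assoc]

/-- The monoid `CA(M, A)` of all cellular automata `τ : A^M → A^M`, i.e. of all self-maps of `A^M`
that are continuous for the product topology and commute with the shift. The operation
(inherited from `Function.End`) is the composition of maps and the identity element is the identity
map. When `A` carries the discrete topology, the topology on `M → A` is the prodiscrete one. -/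
def CA (M A : Type*) [Monoid M] [TopologicalSpace A] : Submonoid (Function.End (M → A)) where
  carrier := {τ : (M → A) → (M → A) |
    Continuous τ ∧ ∀ (m : M) (x : M → A), τ (configShift m x) = configShift m (τ x)}
  mul_mem' := by
    rintro τ₁ τ₂ ⟨h₁, e₁⟩ ⟨h₂, e₂⟩
    refine ⟨h₁.comp h₂, fun m x => ?_⟩
    change τ₁ (τ₂ (configShift m x)) = configShift m (τ₁ (τ₂ x))
    rw [e₂, e₁]
  one_mem' := ⟨continuous_id, fun _ _ => rfl⟩

/-- The two generators of the bicyclic monoid. -/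
inductive BicyclicGen : Type
  | p : BicyclicGen
  | q : BicyclicGen

/-- The single defining relation `p q = 1` of the bicyclic monoid. -/
inductive BicyclicRel : FreeMonoid BicyclicGen → FreeMonoid BicyclicGen → Prop
  | pq : BicyclicRel (FreeMonoid.of BicyclicGen.p * FreeMonoid.of BicyclicGen.q) 1

/-- The bicyclic monoid, given by the presentation `⟨p, q : p q = 1⟩`. -/
abbrev BicyclicMonoid : Type := PresentedMonoid BicyclicRel

/-!
The point is that an injective cellular automaton `τ` is surjective. By compactness `τ` has a
finite memory set, `x 1` is determined by finitely many values of `τ x`, and a configuration outside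
the image is excluded from it by finitely many coordinates; let the finite set `K` contain all three
sets. Reading the local rule of `τ` along a sofic approximation of `M` on `D` gives a self-map `φ`
of `A^D` that behaves like `τ` at the locally free points of `D`, which are almost all of `D`.
Injectivity makes the range of `φ` nearly as large as `A^D`: knowing the coordinates at the few
bad points, one recovers `y` from `φ y`. If some pattern on `K` did not occur in the image of `τ`,
then `φ y` would avoid it at each locally free point. Since the fibres of the approximation are
bounded independently of its quality, a fixed proportion of these points have pairwise disjoint
`K`-windows, so avoiding a pattern would make the range exponentially smaller than `A^D`.
-/

section Compactness

variable {X ι : Type*} {Y : ι → Type*} [TopologicalSpace X] [CompactSpace X]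
  [∀ i, TopologicalSpace (Y i)]

theorem exists_finset_eq_of_forall_eq {Z : Type*} [∀ i, T2Space (Y i)] [TopologicalSpace Z]
    [DiscreteTopology Z] {f : ∀ i, X → Y i} (hf : ∀ i, Continuous (f i)) {g : X → Z}
    (hg : Continuous g) (h : ∀ x y, (∀ i, f i x = f i y) → g x = g y) :
    ∃ F : Finset ι, ∀ x y, (∀ i ∈ F, f i x = f i y) → g x = g y := by
  have separated_closed : IsClosed {p : X × X | g p.1 ≠ g p.2} :=
    (isClosed_discrete {q : Z × Z | q.1 ≠ q.2}).preimage (hg.prodMap hg)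
  obtain ⟨F, hF⟩ := separated_closed.isCompact.elim_finite_subfamily_closed
    (fun i => {p : X × X | f i p.1 = f i p.2})
    (fun i => isClosed_eq ((hf i).comp continuous_fst) ((hf i).comp continuous_snd))
    (Set.eq_empty_of_forall_notMem fun p ⟨hne, heq⟩ => hne (h _ _ (Set.mem_iInter.1 heq)))
  refine ⟨F, fun x y hxy => by_contra fun hne => ?_⟩
  exact Set.eq_empty_iff_forall_notMem.1 hF (x, y) ⟨hne, Set.mem_iInter₂.2 hxy⟩

theorem exists_finset_forall_exists_ne_of_notMem_range [∀ i, T1Space (Y i)] {f : X → ∀ i, Y i}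
    (hf : Continuous f) {z : ∀ i, Y i} (hz : z ∉ Set.range f) :
    ∃ F : Finset ι, ∀ x, ∃ i ∈ F, f x i ≠ z i := by
  obtain ⟨F, hF⟩ := isCompact_univ.elim_finite_subfamily_closed (fun i => {x | f x i = z i})
    (fun i => isClosed_singleton.preimage ((continuous_apply i).comp hf))
    (Set.eq_empty_of_forall_notMem fun x ⟨_, heq⟩ => hz ⟨x, funext (Set.mem_iInter.1 heq)⟩)
  refine ⟨F, fun x => ?_⟩
  by_contra! heq
  exact Set.eq_empty_iff_forall_notMem.1 hF x ⟨trivial, Set.mem_iInter₂.2 heq⟩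

theorem exists_finset_dependsOn {A Z : Type*} [TopologicalSpace A] [CompactSpace A]
    [T2Space A] [TopologicalSpace Z] [DiscreteTopology Z] {g : (ι → A) → Z}
    (hg : Continuous g) : ∃ F : Finset ι, DependsOn g (F : Set ι) :=
  exists_finset_eq_of_forall_eq continuous_apply hg fun _ _ h => congrArg g (funext h)

end Compactness

section FiniteModel

/-- An equivariant self-map of `A^M` is determined by its local rule `x ↦ τ x 1`, which can be read
along any family `σ` of self-maps of `D` instead of along the translations of `M`: this is the
resulting self-map of `A^D`, with `m ↦ y (σ m v)` as the configuration seen from `v`. -/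
def finiteModel {M A D : Type*} [Monoid M] (τ : (M → A) → M → A) (σ : M → D → D) (y : D → A) :
    D → A :=
  fun v => τ (fun m => y (σ m v)) 1

variable {M A D : Type*} [Monoid M] {τ : (M → A) → M → A} {σ : M → D → D} {F : Set M}

theorem finiteModel_apply (hτ : ∀ m, Function.Commute τ (configShift m))
    (hF : DependsOn (fun x => τ x 1) F) {t : M} {v : D}
    (hv : ∀ s ∈ F, σ (s * t) v = σ s (σ t v)) (y : D → A) :
    finiteModel τ σ y (σ t v) = τ (fun m => y (σ m v)) t :=
  calc τ (fun m => y (σ m (σ t v))) 1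
      = τ (configShift t fun m => y (σ m v)) 1 := hF fun s hs => congrArg y (hv s hs).symm
    _ = configShift t (τ fun m => y (σ m v)) 1 := congrFun (hτ t _) 1
    _ = τ (fun m => y (σ m v)) t := by simp only [configShift, one_mul]

end FiniteModel

section Packing

theorem ncard_biUnion_le_mul {ι D : Type*} (t : Finset ι) (s : ι → Set D) {n : ℕ}
    (h : ∀ i ∈ t, (s i).ncard ≤ n) : (⋃ i ∈ t, s i).ncard ≤ t.card * n :=
  (t.set_ncard_biUnion_le s).trans (Finset.sum_le_card_nsmul t _ n h)

theorem exists_pairwiseDisjoint_and_ncard_le_mul {ι E : Type*} [Finite ι] {W : ι → Set E}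
    {S : Set ι} (hW : ∀ v ∈ S, (W v).Nonempty) {N : ℕ}
    (hN : ∀ v ∈ S, {w | ¬ Disjoint (W v) (W w)}.ncard ≤ N) :
    ∃ V : Finset ι, (V : Set ι) ⊆ S ∧ (V : Set ι).PairwiseDisjoint W ∧ S.ncard ≤ V.card * N := by
  classical
  obtain ⟨V, ⟨hVS, hV⟩, hmax⟩ := (Set.toFinite {V : Finset ι | (V : Set ι) ⊆ S ∧
    (V : Set ι).PairwiseDisjoint W}).exists_maximal ⟨∅, by simp⟩
  have cover : S ⊆ ⋃ v ∈ V, {w | ¬ Disjoint (W v) (W w)} := by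
    intro w hw
    by_contra hwV
    have hdisj : ∀ v ∈ V, Disjoint (W v) (W w) := by simpa using hwV
    have hmem : w ∈ V := by
      refine hmax ⟨?_, ?_⟩ (Finset.subset_insert w V) (Finset.mem_insert_self w V)
      · simpa [Set.insert_subset_iff] using ⟨hw, hVS⟩
      · rw [Finset.coe_insert]
        exact hV.insert fun v hv _ => (hdisj v hv).symm
    exact (hW w hw).ne_empty (disjoint_self.1 (hdisj w hmem))
  exact ⟨V, hVS, hV,
    (Set.ncard_le_ncard cover).trans (ncard_biUnion_le_mul V _ fun v hv => hN v (hVS hv))⟩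

theorem ncard_setOf_not_disjoint_image_le {M D : Type*} [Finite D] {σ : M → D → D}
    {K : Finset M} {Δ : ℕ} (hσ : ∀ k ∈ K, ∀ v, (σ k ⁻¹' {v}).ncard ≤ Δ) (v : D) :
    {w | ¬ Disjoint ((fun k => σ k v) '' K) ((fun k => σ k w) '' K)}.ncard ≤ K.card ^ 2 * Δ := by
  have cover : {w | ¬ Disjoint ((fun k => σ k v) '' K) ((fun k => σ k w) '' K)} ⊆
      ⋃ p ∈ K ×ˢ K, σ p.1 ⁻¹' {σ p.2 v} := by
    intro w hw
    obtain ⟨_, ⟨l, hl, rfl⟩, k, hk, hkl⟩ := Set.not_disjoint_iff.1 hw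
    exact Set.mem_biUnion (x := (k, l)) (Finset.mk_mem_product hk hl) hkl
  calc _ ≤ (⋃ p ∈ K ×ˢ K, σ p.1 ⁻¹' {σ p.2 v}).ncard := Set.ncard_le_ncard cover
    _ ≤ (K ×ˢ K).card * Δ :=
        ncard_biUnion_le_mul _ _ fun p hp => hσ p.1 (Finset.mem_product.1 hp).1 _
    _ = K.card ^ 2 * Δ := by rw [Finset.card_product, sq]

theorem exists_injective_and_ncard_le_mul {M D : Type*} [Finite D] {σ : M → D → D}
    {K : Finset M} (hK : K.Nonempty) {Δ : ℕ} (hσ : ∀ k ∈ K, ∀ v, (σ k ⁻¹' {v}).ncard ≤ Δ)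
    {S : Set D} (hS : ∀ v ∈ S, Set.InjOn (fun k => σ k v) K) :
    ∃ V : Finset D, (V : Set D) ⊆ S ∧
      Function.Injective (fun p : V × K => σ p.2 p.1) ∧ S.ncard ≤ V.card * (K.card ^ 2 * Δ) := by
  obtain ⟨V, hVS, hdisj, hcard⟩ := exists_pairwiseDisjoint_and_ncard_le_mul
    (fun v (_ : v ∈ S) => (Finset.coe_nonempty.2 hK).image fun k => σ k v)
    (fun v _ => ncard_setOf_not_disjoint_image_le hσ v)
  refine ⟨V, hVS, ?_, hcard⟩
  rintro ⟨v, k⟩ ⟨w, l⟩ (heq : σ k v = σ l w)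
  have hvw : (v : D) = w := hdisj.elim v.2 w.2 (Set.not_disjoint_iff.2
    ⟨σ k v, Set.mem_image_of_mem _ k.2, heq ▸ Set.mem_image_of_mem _ l.2⟩)
  have hkl : (k : M) = l := hS v (hVS v.2) k.2 l.2 (by simpa only [hvw] using heq)
  exact Prod.ext (Subtype.ext hvw) (Subtype.ext hkl)

end Packing

section SoficApproximation

/-- The family `σ` of self-maps of `D` looks, from `v` and up to the finite set `K`, like the
action of `M` on itself: it is multiplicative on `K` at `v` and moves `v` to distinct points. -/
structure IsLocallyFreeAt {M D : Type*} [Monoid M] (σ : M → D → D) (K : Finset M) (v : D) :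
    Prop where
  map_mul : ∀ s ∈ K, ∀ t ∈ K, σ (s * t) v = σ s (σ t v)
  injOn : Set.InjOn (fun k => σ k v) K

theorem ncard_setOf_ne_le_of_hammingMetric_le {D : Type*} [Finite D] [Nonempty D] {f g : D → D}
    {ε : ℝ} (h : hammingMetric f g ≤ ε) : ({v | f v ≠ g v}.ncard : ℝ) ≤ ε * Nat.card D :=
  (div_le_iff₀ (by exact_mod_cast Nat.card_pos)).1 h

theorem ncard_setOf_eq_le_of_one_sub_le_hammingMetric {D : Type*} [Finite D] [Nonempty D]
    {f g : D → D} {ε : ℝ} (h : 1 - ε ≤ hammingMetric f g) :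
    ({v | f v = g v}.ncard : ℝ) ≤ ε * Nat.card D := by
  have hne : (1 - ε) * Nat.card D ≤ ({v | f v ≠ g v}.ncard : ℝ) :=
    (le_div_iff₀ (by exact_mod_cast Nat.card_pos)).1 h
  have htotal : ({v | f v = g v}.ncard + {v | f v ≠ g v}.ncard : ℝ) = Nat.card D := by
    exact_mod_cast Set.ncard_add_ncard_compl {v | f v = g v}
  linarith

theorem ncard_setOf_not_isLocallyFreeAt_le {M D : Type*} [Monoid M] [Finite D] [Nonempty D]
    {σ : M → D → D} {K : Finset M} {ε : ℝ} (hε : 0 ≤ ε)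
    (hmul : ∀ s ∈ K, ∀ t ∈ K, hammingMetric (σ (s * t)) (σ s ∘ σ t) ≤ ε)
    (hsep : ∀ s ∈ K, ∀ t ∈ K, s ≠ t → 1 - ε ≤ hammingMetric (σ s) (σ t)) :
    ({v | ¬ IsLocallyFreeAt σ K v}.ncard : ℝ) ≤ 2 * K.card ^ 2 * (ε * Nat.card D) := by
  have cover : {v | ¬ IsLocallyFreeAt σ K v} ⊆ ⋃ p ∈ K ×ˢ K,
      {v | σ (p.1 * p.2) v ≠ (σ p.1 ∘ σ p.2) v} ∪ {v | p.1 ≠ p.2 ∧ σ p.1 v = σ p.2 v} := by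
    intro v hv
    by_contra hnot
    simp only [Set.mem_iUnion, exists_prop, not_exists, not_and] at hnot
    exact hv ⟨fun s hs t ht => by_contra fun h =>
        hnot (s, t) (Finset.mk_mem_product hs ht) (.inl h),
      fun s hs t ht h => by_contra fun hne =>
        hnot (s, t) (Finset.mk_mem_product hs ht) (.inr ⟨hne, h⟩)⟩
  have coincidence_le : ∀ s ∈ K, ∀ t ∈ K,
      ({v | s ≠ t ∧ σ s v = σ t v}.ncard : ℝ) ≤ ε * Nat.card D := fun s hs t ht => by
    rcases eq_or_ne s t with rfl | hst
    · simpa using mul_nonneg hε (Nat.cast_nonneg (Nat.card D))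
    · simpa [hst] using ncard_setOf_eq_le_of_one_sub_le_hammingMetric (hsep s hs t ht hst)
  calc ({v | ¬ IsLocallyFreeAt σ K v}.ncard : ℝ)
      ≤ ∑ p ∈ K ×ˢ K, ({v | σ (p.1 * p.2) v ≠ (σ p.1 ∘ σ p.2) v} ∪
          {v | p.1 ≠ p.2 ∧ σ p.1 v = σ p.2 v}).ncard := by
        exact_mod_cast (Set.ncard_le_ncard cover).trans (Finset.set_ncard_biUnion_le _ _)
    _ ≤ ∑ p ∈ K ×ˢ K, 2 * (ε * Nat.card D) := by
        push_cast
        refine Finset.sum_le_sum fun p hp => ?_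
        obtain ⟨hs, ht⟩ := Finset.mem_product.1 hp
        rw [two_mul]
        exact le_trans (by exact_mod_cast Set.ncard_union_le _ _)
          (add_le_add (ncard_setOf_ne_le_of_hammingMetric_le (hmul _ hs _ ht))
            (coincidence_le _ hs _ ht))
    _ = 2 * K.card ^ 2 * (ε * Nat.card D) := by
        rw [Finset.sum_const, Finset.card_product, nsmul_eq_mul]
        push_cast
        ring

theorem StronglySofic.exists_mul_ncard_not_isLocallyFreeAt_le {M : Type*} [Monoid M]
    (hM : StronglySofic M) (K : Finset M) :
    ∃ Δ : ℕ, ∀ L : ℕ, ∃ (D : Type) (_ : Finite D) (_ : Nonempty D) (σ : M → D → D),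
      σ 1 = id ∧ (∀ k ∈ K, ∀ v, (σ k ⁻¹' {v}).ncard ≤ Δ) ∧
      L * {v | ¬ IsLocallyFreeAt σ K v}.ncard ≤ Nat.card D := by
  obtain ⟨Δ, -, h⟩ := hM K
  refine ⟨Δ, fun L => ?_⟩
  set ε : ℝ := (2 * K.card ^ 2 * L + 1 : ℝ)⁻¹
  have hε : 0 < ε := by positivity
  have hLε : 2 * K.card ^ 2 * L * ε ≤ 1 := by
    rw [← div_eq_mul_inv, div_le_one (by positivity)]
    linarith
  obtain ⟨D, _, _, σ, hone, hmul, hsep, hfib⟩ := h ε hε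
  refine ⟨D, ‹_›, ‹_›, σ, hone, hfib, ?_⟩
  have hreal : (L * {v | ¬ IsLocallyFreeAt σ K v}.ncard : ℝ) ≤ Nat.card D :=
    calc (L * {v | ¬ IsLocallyFreeAt σ K v}.ncard : ℝ)
        ≤ L * (2 * K.card ^ 2 * (ε * Nat.card D)) := by
          gcongr
          exact ncard_setOf_not_isLocallyFreeAt_le hε.le hmul hsep
      _ = 2 * K.card ^ 2 * L * ε * Nat.card D := by ring
      _ ≤ Nat.card D := mul_le_of_le_one_left (Nat.cast_nonneg _) hLε
  exact_mod_cast hreal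

theorem StronglySofic.exists_packing {M : Type*} [Monoid M] (hM : StronglySofic M)
    {K : Finset M} (hK : K.Nonempty) (T : ℕ) :
    ∃ (D : Type) (_ : Finite D) (σ : M → D → D) (V : Finset D), σ 1 = id ∧
      (∀ v ∈ V, IsLocallyFreeAt σ K v) ∧ Function.Injective (fun p : V × K => σ p.2 p.1) ∧
      T * {v | ¬ IsLocallyFreeAt σ K v}.ncard < V.card := by
  obtain ⟨Δ, happrox⟩ := hM.exists_mul_ncard_not_isLocallyFreeAt_le K
  set N := K.card ^ 2 * Δ
  obtain ⟨D, _, _, σ, hone, hfib, hbad⟩ := happrox (T * N + 2)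
  obtain ⟨V, hV, hinj, (hcard : _ ≤ V.card * N)⟩ := exists_injective_and_ncard_le_mul hK hfib
    (S := {v | IsLocallyFreeAt σ K v}) fun v hv => hv.injOn
  refine ⟨D, ‹_›, σ, V, hone, hV, hinj, ?_⟩
  set b := {v | ¬ IsLocallyFreeAt σ K v}.ncard
  have htotal : {v | IsLocallyFreeAt σ K v}.ncard + b = Nat.card D :=
    Set.ncard_add_ncard_compl {v | IsLocallyFreeAt σ K v}
  by_contra! hle
  have hgood : V.card * N ≤ T * b * N := Nat.mul_le_mul_right N hle
  have hb : b = 0 := by nlinarith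
  have hD : Nat.card D = 0 := by
    rw [hb, mul_zero, zero_mul] at hgood
    omega
  exact Nat.card_pos.ne' hD

end SoficApproximation

section Counting

variable {A D ι κ : Type*} [Finite A] [Finite D]

theorem card_pow_le_ncard_range_mul {f : (D → A) → D → A} {B : Set D}
    (hf : ∀ y₁ y₂, f y₁ = f y₂ → ∀ v ∉ B, y₁ v = y₂ v) :
    Nat.card A ^ Nat.card D ≤ (Set.range f).ncard * Nat.card A ^ B.ncard := by
  have inj : Function.Injective fun y : D → A => (Set.rangeFactorization f y, B.domRestrict y) := by
    intro y₁ y₂ h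
    obtain ⟨hrange, hB⟩ := Prod.mk.inj h
    funext v
    by_cases hv : v ∈ B
    · exact congrFun hB ⟨v, hv⟩
    · exact hf y₁ y₂ (congrArg Subtype.val hrange) v hv
  simpa only [Nat.card_fun, Nat.card_prod, Nat.card_coe_set_eq] using
    Nat.card_le_card_of_injective _ inj

theorem natCast_card_subtype_ne {Q : Type*} [Finite Q] (q : Q) :
    (Nat.card {q' // q' ≠ q} : ℝ) = Nat.card Q - 1 := by
  have htotal : ({q} : Set Q).ncard + Nat.card {q' // q' ≠ q} = Nat.card Q :=
    Set.ncard_add_ncard_compl {q}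
  rw [← htotal, Set.ncard_singleton, Nat.cast_add, Nat.cast_one, add_sub_cancel_left]

theorem ncard_setOf_forall_ne_le [Finite ι] [Finite κ] [Nonempty A] {e : ι × κ → D}
    (he : Function.Injective e) (p : κ → A) :
    ({y : D → A | ∀ i, (fun k => y (e (i, k))) ≠ p}.ncard : ℝ) ≤
      (1 - ((Nat.card A : ℝ) ^ Nat.card κ)⁻¹) ^ Nat.card ι * (Nat.card A : ℝ) ^ Nat.card D := by
  set Y := {y : D → A | ∀ i, (fun k => y (e (i, k))) ≠ p}
  let R := (Set.range e)ᶜ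
  have inj : Function.Injective (β := (ι → {q : κ → A // q ≠ p}) × (R → A)) fun y : Y =>
      (fun i => ⟨fun k => y.1 (e (i, k)), y.2 i⟩, R.domRestrict y.1) := by
    intro y₁ y₂ h
    obtain ⟨hrange, hcompl⟩ := Prod.mk.inj h
    ext v
    by_cases hv : v ∈ Set.range e
    · obtain ⟨⟨i, k⟩, rfl⟩ := hv
      exact congrFun (congrArg Subtype.val (congrFun hrange i)) k
    · exact congrFun hcompl ⟨v, hv⟩
  have hcount := Nat.card_le_card_of_injective _ inj
  rw [Nat.card_prod, Nat.card_fun, Nat.card_fun, Nat.card_coe_set_eq] at hcount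
  have hD : Nat.card κ * Nat.card ι + Nat.card R = Nat.card D := by
    rw [mul_comm, ← Nat.card_prod, ← Set.ncard_range_of_injective he, Nat.card_coe_set_eq]
    exact Set.ncard_add_ncard_compl _
  have ha : (Nat.card A : ℝ) ≠ 0 := by exact_mod_cast Nat.card_pos.ne'
  calc (Y.ncard : ℝ)
      ≤ (Nat.card {q : κ → A // q ≠ p} : ℝ) ^ Nat.card ι * (Nat.card A : ℝ) ^ Nat.card R := by
        exact_mod_cast hcount
    _ = (1 - ((Nat.card A : ℝ) ^ Nat.card κ)⁻¹) ^ Nat.card ι *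
          (Nat.card A : ℝ) ^ Nat.card D := by
        rw [natCast_card_subtype_ne, Nat.card_fun, ← hD, pow_add, pow_mul, ← mul_assoc, ← mul_pow]
        congr 2
        push_cast
        field_simp

theorem exists_pow_mul_pow_lt_one {r a : ℝ} (hr₀ : 0 ≤ r) (hr₁ : r < 1) (ha : 0 < a) :
    ∃ T : ℕ, ∀ b n : ℕ, T * b < n → r ^ n * a ^ b < 1 := by
  obtain ⟨T, hT⟩ := exists_pow_lt_of_lt_one (inv_pos.2 ha) hr₁
  refine ⟨T, fun b n hn => ?_⟩
  obtain ⟨k, rfl⟩ := Nat.exists_eq_add_of_lt hn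
  calc r ^ (T * b + k + 1) * a ^ b = r ^ (k + 1) * (r ^ T * a) ^ b := by ring
    _ < 1 := mul_lt_one_of_nonneg_of_lt_one_left (by positivity)
        (pow_lt_one₀ hr₀ hr₁ k.succ_ne_zero)
        (pow_le_one₀ (by positivity) ((lt_inv_mul_iff₀' ha).1 (by simpa using hT)).le)

theorem exists_one_sub_inv_pow_mul_pow_lt_one {a : ℕ} (ha : 0 < a) (n : ℕ) :
    ∃ T : ℕ, ∀ b m : ℕ, T * b < m → (1 - ((a : ℝ) ^ n)⁻¹) ^ m * (a : ℝ) ^ b < 1 := by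
  have ha' : (1 : ℝ) ≤ a := by exact_mod_cast ha
  exact exists_pow_mul_pow_lt_one (sub_nonneg.2 (inv_le_one_of_one_le₀ (one_le_pow₀ ha')))
    (sub_lt_self 1 (by positivity)) (by positivity)

theorem exists_forall_pattern_eq [Finite ι] [Finite κ] [Nonempty A] {f : (D → A) → D → A}
    {B : Set D} (hf : ∀ y₁ y₂, f y₁ = f y₂ → ∀ v ∉ B, y₁ v = y₂ v) {e : ι × κ → D}
    (he : Function.Injective e)
    (hB : (1 - ((Nat.card A : ℝ) ^ Nat.card κ)⁻¹) ^ Nat.card ι * (Nat.card A : ℝ) ^ B.ncard < 1)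
    (p : κ → A) : ∃ y i, ∀ k, f y (e (i, k)) = p k := by
  have ha : (0 : ℝ) < Nat.card A := by exact_mod_cast Nat.card_pos
  by_contra! havoid
  set Y := {y : D → A | ∀ i, (fun k => y (e (i, k))) ≠ p}
  have hrange : Set.range f ⊆ Y := by
    rintro _ ⟨y, rfl⟩ i heq
    obtain ⟨k, hk⟩ := havoid y i
    exact hk (congrFun heq k)
  set r := 1 - ((Nat.card A : ℝ) ^ Nat.card κ)⁻¹
  refine lt_irrefl ((Nat.card A : ℝ) ^ Nat.card D) ?_
  calc (Nat.card A : ℝ) ^ Nat.card D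
      ≤ (Set.range f).ncard * (Nat.card A : ℝ) ^ B.ncard := by
        exact_mod_cast card_pow_le_ncard_range_mul hf
    _ ≤ Y.ncard * (Nat.card A : ℝ) ^ B.ncard := by
        gcongr
        exact Set.toFinite _
    _ ≤ r ^ Nat.card ι * (Nat.card A : ℝ) ^ Nat.card D * (Nat.card A : ℝ) ^ B.ncard := by
        gcongr
        exact ncard_setOf_forall_ne_le he p
    _ = r ^ Nat.card ι * (Nat.card A : ℝ) ^ B.ncard * (Nat.card A : ℝ) ^ Nat.card D := by ring
    _ < (Nat.card A : ℝ) ^ Nat.card D := mul_lt_of_lt_one_left (by positivity) hB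

end Counting

namespace StronglySofic

variable {M A : Type*} [Monoid M] (hM : StronglySofic M) [Finite A] [TopologicalSpace A]
  [DiscreteTopology A]

include hM

theorem exists_forall_mem_apply_eq {τ : (M → A) → M → A} (hc : Continuous τ)
    (hτ : ∀ m, Function.Commute τ (configShift m)) (hinj : Function.Injective τ) (Ω : Finset M)
    (z : M → A) : ∃ x, ∀ m ∈ Ω, τ x m = z m := by
  classical
  have : Nonempty A := ⟨z 1⟩
  obtain ⟨F, hF⟩ := exists_finset_dependsOn ((continuous_apply (1 : M)).comp hc)
  obtain ⟨G, hG⟩ := exists_finset_eq_of_forall_eq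
    (fun m => (continuous_apply m).comp hc) (continuous_apply (1 : M))
    fun x y h => congrFun (hinj (funext h)) 1
  obtain ⟨K, hK, hFK, hGK, hΩK⟩ : ∃ K : Finset M, K.Nonempty ∧ F ⊆ K ∧ G ⊆ K ∧ Ω ⊆ K :=
    ⟨insert 1 (F ∪ G ∪ Ω), by grind⟩
  obtain ⟨T, hT⟩ :=
    exists_one_sub_inv_pow_mul_pow_lt_one (a := Nat.card A) Nat.card_pos (Nat.card K)
  obtain ⟨D, _, σ, V, hone, hfree, hwindows, hcard⟩ := hM.exists_packing hK T
  have model_apply {v : D} (hv : IsLocallyFreeAt σ K v) {t : M} (ht : t ∈ K) (y : D → A) :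
      finiteModel τ σ y (σ t v) = τ (fun m => y (σ m v)) t :=
    finiteModel_apply hτ hF (fun s hs => hv.map_mul s (hFK hs) t ht) y
  have model_inj (y₁ y₂ : D → A) (h : finiteModel τ σ y₁ = finiteModel τ σ y₂)
      (v : D) (hv : v ∉ {v | ¬ IsLocallyFreeAt σ K v}) : y₁ v = y₂ v := by
    have hv := not_not.1 hv
    simpa [hone] using hG (fun m => y₁ (σ m v)) (fun m => y₂ (σ m v)) fun t ht =>
      (model_apply hv (hGK ht) y₁).symm.trans
        ((congrFun h _).trans (model_apply hv (hGK ht) y₂))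
  obtain ⟨y, v, hyv⟩ := exists_forall_pattern_eq model_inj hwindows
    (hT _ _ (by simpa using hcard)) fun k : K => z k
  exact ⟨fun m => y (σ m v), fun m hm =>
    (model_apply (hfree v v.2) (hΩK hm) y).symm.trans (hyv ⟨m, hΩK hm⟩)⟩

theorem surjective_of_injective {τ : (M → A) → M → A} (hc : Continuous τ)
    (hτ : ∀ m, Function.Commute τ (configShift m)) (hinj : Function.Injective τ) :
    Function.Surjective τ := fun z => by
  by_contra hz
  obtain ⟨Ω, hΩ⟩ := exists_finset_forall_exists_ne_of_notMem_range hc hz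
  obtain ⟨x, hx⟩ := hM.exists_forall_mem_apply_eq hc hτ hinj Ω z
  obtain ⟨m, hm, hne⟩ := hΩ x
  exact hne (hx m hm)

theorem isDedekindFiniteMonoid_CA : IsDedekindFiniteMonoid (CA M A) where
  mul_eq_one_symm {τ τ'} h := by
    have hleft : Function.LeftInverse τ.1 τ'.1 := congrFun (congrArg Subtype.val h)
    have hsurj : Function.Surjective τ'.1 :=
      hM.surjective_of_injective τ'.2.1 τ'.2.2 hleft.injective
    exact Subtype.ext (funext (hleft.rightInverse_of_surjective hsurj))

end StronglySofic

theorem BicyclicMonoid.of_p_mul_of_q :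
    (PresentedMonoid.of BicyclicRel .p * PresentedMonoid.of BicyclicRel .q : BicyclicMonoid) = 1 :=
  PresentedMonoid.mk_eq_mk_of_rel BicyclicRel.pq

/-- The action of the bicyclic monoid on `ℕ` in which `p` is the predecessor map, with `0` fixed,
and `q` is the successor map. -/
def BicyclicMonoid.toEndNat : BicyclicMonoid →* Function.End ℕ :=
  PresentedMonoid.lift (fun | .p => Nat.pred | .q => Nat.succ) (by rintro _ _ ⟨⟩; rfl)

theorem BicyclicMonoid.not_isDedekindFiniteMonoid : ¬ IsDedekindFiniteMonoid BicyclicMonoid := by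
  intro _
  have h := congrArg toEndNat (mul_eq_one_symm of_p_mul_of_q)
  exact Nat.succ_ne_zero 0 (congrFun h 0)

theorem corollary1p2 {M A : Type*} [Monoid M] (hM : StronglySofic M)
    [Finite A] [TopologicalSpace A] [DiscreteTopology A] :
    IsDedekindFiniteMonoid (CA M A) ∧
      ¬ ∃ N : Submonoid (CA M A), Nonempty (N ≃* BicyclicMonoid) := by
  have hfinite : IsDedekindFiniteMonoid (CA M A) := hM.isDedekindFiniteMonoid_CA
  refine ⟨hfinite, fun ⟨N, ⟨φ⟩⟩ => BicyclicMonoid.not_isDedekindFiniteMonoid ?_⟩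
  exact .of_injective (N.subtype.comp φ.symm.toMonoidHom)
    (N.subtype_injective.comp φ.symm.injective)
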